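/- Let $m$ be odd, let $\mathbb F_{2^m}$ be the field with $2^m$ elements, with trace $\mathrm{tr}(x)=\sum_{i=0}^{m-1}x^{2^i}\in\mathbb F_2$, and let $d\ge 0$ be an integer such that the power function $x\mapsto x^d$ on $\mathbb F_{2^m}$ is maximum nonlinear (almost bent), that is, $$\max_{\beta,\gamma\in\mathbb F_{2^m},\ \beta\ne 0}\Bigl|\sum_{x\in\mathbb F_{2^m}}(-1)^{\mathrm{tr}(\gamma x+\beta x^d)}\Bigr|=2^{\frac{m+1}{2}}.$$ Put $D_d=\{x\in\mathbb F_{2^m}:\mathrm{tr}(x^d)=1\}$ and $H^{i,j}(\alpha,\beta)=\{x\in\mathbb F_{2^m}:\mathrm{tr}(\alpha x)=i,\ \mathrm{tr}(\beta x)=j\}$. Consider the condition $$(\ast)\qquad |H^{i,j}(\alpha,\beta)\cap D_d|\in\bigl\{2^{m-3},\ 2^{m-3}\pm 2^{\frac{m-3}{2}}\bigr\}\quad\text{for all }\alpha,\beta\in\mathbb F_{2^m}\setminus\{0\},\ \alpha\ne\beta,\text{ and all }i,j\in\mathbb F_2.$$ (a) Condition $(\ast)$ holds if and only if $d$ is a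 Gold exponent up to multiplication by powers of $2$ modulo $2^m-1$, i.e. $d\equiv 2^i(2^k+1)\pmod{2^m-1}$ for some integers $i,k\ge 0$ with $\gcd(k,m)=1$. (b) If moreover $d$ is odd and $d<2^m-1$, then $(\ast)$ holds if and only if $d=2^k+1$ for some integer $k\ge 0$ with $\gcd(k,m)=1$. -/

import Mathlib

/-- The integer sign `(-1)^a` of an element `a` of the field with two elements. -/
def binarySign (a : ZMod 2) : ℤ := (-1) ^ a.val

/-- The absolute trace of a finite field of characteristic two. -/
noncomputable def absTrace {F : Type*} [Field F] [Algebra (ZMod 2) F] (x : F) : ZMod 2 :=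
  Algebra.trace (ZMod 2) F x

/-- The Walsh coefficient `∑ x, (-1)^(tr (γ x) + f x)` of a boolean function `f`. -/
noncomputable def walshCoeff {F : Type*} [Field F] [Fintype F] [Algebra (ZMod 2) F]
    (f : F → ZMod 2) (γ : F) : ℤ :=
  ∑ x : F, binarySign (absTrace (γ * x) + f x)

/-- The linearity of a boolean function: the maximum of the absolute values of its
Walsh coefficients. -/
noncomputable def boolLinearity {F : Type*} [Field F] [Fintype F] [Algebra (ZMod 2) F]
    (f : F → ZMod 2) : ℕ :=
  Finset.univ.sup fun γ : F => (walshCoeff f γ).natAbs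

open Classical in
/-- The linearity of a vectorial function `G : F → F`: the maximum of the linearities of its
coordinate functions `x ↦ tr (β * G x)`, `β ≠ 0`. -/
noncomputable def vectLinearity {F : Type*} [Field F] [Fintype F] [Algebra (ZMod 2) F]
    (G : F → F) : ℕ :=
  (Finset.univ.filter fun β : F => β ≠ 0).sup fun β => boolLinearity fun x => absTrace (β * G x)

/-- `G` is maximum nonlinear (almost bent): its linearity is `2^((m+1)/2)`, where `m` is the degree
of `F` over the field with two elements, which has to be odd for this. -/
def IsMaximumNonlinear {F : Type*} [Field F] [Fintype F] [Algebra (ZMod 2) F]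
    (G : F → F) : Prop :=
  Odd (Module.finrank (ZMod 2) F) ∧
    vectLinearity G = 2 ^ ((Module.finrank (ZMod 2) F + 1) / 2)

/-- The set `D_d` of all `x` with `tr (x^d) = 1`. -/
def powerTraceSet (F : Type*) [Field F] [Algebra (ZMod 2) F] (d : ℕ) : Set F :=
  {x | absTrace (x ^ d) = 1}

/-- The set `H^{i,j}(α, β)` of all `x` with `tr (α x) = i` and `tr (β x) = j`. -/
def codimTwoSet {F : Type*} [Field F] [Algebra (ZMod 2) F] (i j : ZMod 2) (α β : F) : Set F :=
  {x | absTrace (α * x) = i ∧ absTrace (β * x) = j}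

/-- All sets `H^{i,j}(α, β)`, for distinct nonzero `α`, `β`, meet `D_d` in `2^(m-3)` or
`2^(m-3) ± 2^((m-3)/2)` points. Distinct nonzero `α`, `β` exist only for `m ≥ 2`, so that for odd
`m` the subtraction and the division in the exponents are exact. -/
def HasQuadricIntersections (F : Type*) [Field F] [Algebra (ZMod 2) F] (m d : ℕ) : Prop :=
  ∀ α β : F, α ≠ 0 → β ≠ 0 → α ≠ β → ∀ i j : ZMod 2,
    ((codimTwoSet i j α β ∩ powerTraceSet F d).ncard : ℤ) ∈
      ({2 ^ (m - 3), 2 ^ (m - 3) + 2 ^ ((m - 3) / 2), 2 ^ (m - 3) - 2 ^ ((m - 3) / 2)} : Set ℤ)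

/-- `d = 2^k + 1` for some `k` with `gcd (k, m) = 1`. -/
def IsGoldExponent (m d : ℕ) : Prop :=
  ∃ k : ℕ, Nat.gcd k m = 1 ∧ d = 2 ^ k + 1

/-- `d` is a Gold exponent up to multiplication by a power of two modulo `2^m - 1`, that is, up to
reduction of the exponent and composition of `x^d` with a field automorphism. -/
def IsGoldExponentUpToConj (m d : ℕ) : Prop :=
  ∃ e i : ℕ, IsGoldExponent m e ∧ d ≡ 2 ^ i * e [MOD 2 ^ m - 1]

/-! Write q = 2^m and W(γ) for the Walsh coefficient of tr(x^d) at γ, and let m ≥ 3 (m = 1 is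
degenerate). Parseval and a fourth-moment bound force W² ∈ {0, 2q} for an almost bent function
(`walsh_sq_eq_of_le`), and a divisibility argument makes x^d a permutation, so W(0) = 0. Expanding
indicator functions in characters, 8|H ∩ D_d| is q minus a signed sum of W(α), W(β), W(α + β). Hence
(∗) says that an even number of these three are nonzero, that is, the Walsh support is the
complement of the kernel of an additive functional. Frobenius invariance identifies that functional
with the trace, and Fourier inversion turns this into tr((x+1)^d + x^d) = 1 for all x.

Gold exponents satisfy this identity by direct computation. Conversely, let I ⊆ ℤ/m be the set of
binary digits of d mod 2^m − 1. Comparing coefficients in the identity shows that each nonempty K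
with fewer elements than I lies in an even number of cyclic translates of I, while I lies only in
itself because x^d is a permutation. A counting argument (`card_le_two_of_even_translates`) then
gives |I| ≤ 2. One digit would make x^d additive; two digits give 2^i(2^k + 1), and gcd(k, m) > 1
would produce constant derivatives that the autocorrelation rules out. -/

open Finset

/-! ### Combinatorics of translates -/

/-- The translates `I + t` containing a set `K` form a family whose size `N K` drops by at least two
with each element added to `K`, if `N` is even on proper nonempty subsets of `I` and `N I = 1`. -/
theorem card_le_two_of_even_translates {G : Type*} [AddCommGroup G] [Fintype G] [DecidableEq G]
    (I : Finset G)
    (heven : ∀ K ⊆ I, K.Nonempty → K ≠ I → Even #{t : G | ∀ k ∈ K, k - t ∈ I})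
    (hone : #{t : G | ∀ k ∈ I, k - t ∈ I} = 1) : #I ≤ 2 := by
  have key : ∀ K : Finset G, K ⊆ I → K.Nonempty → K ≠ I →
      #{t : G | ∀ k ∈ K, k - t ∈ I} + 2 * #K ≤ #I + 2 := by
    intro K
    induction K using Finset.induction_on with
    | empty => intro _ h; simp at h
    | insert k K hk ih =>
      intro hsub _ hne
      have hkI : k ∈ I := hsub (mem_insert_self k K)
      have hKI : K ⊆ I := (subset_insert k K).trans hsub
      rcases K.eq_empty_or_nonempty with rfl | hKn
      · have : #{t : G | ∀ x ∈ insert k (∅ : Finset G), x - t ∈ I} = #I := by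
          refine card_bij (fun t _ => k - t) ?_ ?_ ?_
          · intro t ht; simpa using ht
          · intro a _ b _ h; simpa using h
          · intro b hb; exact ⟨k - b, by simpa using hb, by simp⟩
        rw [this]; simp
      have hKne : K ≠ I := by rintro rfl; exact hk hkI
      have h1 := ih hKI hKn hKne
      have hs : univ.filter (fun t : G => ∀ x ∈ insert k K, x - t ∈ I) ⊆
          univ.filter (fun t : G => ∀ x ∈ K, x - t ∈ I) :=
        monotone_filter_right _ fun t _ ht x hx => ht x (mem_insert_of_mem hx)
      have hlt : #{t : G | ∀ x ∈ insert k K, x - t ∈ I} < #{t : G | ∀ x ∈ K, x - t ∈ I} := by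
        -- Were the counts equal, every translate containing K would contain k, so a translate
        -- containing I \ {k} would contain I. Then N (I \ {k}) = N I = 1 would be odd.
        refine card_lt_card (hs.ssubset_of_ne fun heq => ?_)
        have hKe : K ⊆ I.erase k := fun x hx => mem_erase.2 ⟨by rintro rfl; exact hk hx, hKI hx⟩
        have := heven (I.erase k) (erase_subset k I) (hKn.mono hKe)
          (fun h => by rw [← h] at hkI; simp at hkI)
        have h2 : univ.filter (fun t : G => ∀ x ∈ I.erase k, x - t ∈ I) =
            univ.filter (fun t : G => ∀ x ∈ I, x - t ∈ I) := by
          ext t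
          simp only [mem_filter, mem_univ, true_and]
          refine ⟨fun h x hx => ?_, fun h x hx => h x (mem_of_mem_erase hx)⟩
          by_cases hxk : x = k
          · subst hxk
            have : t ∈ univ.filter (fun t : G => ∀ x ∈ K, x - t ∈ I) := by
              simpa using fun y hy => h y (hKe hy)
            rw [← heq] at this
            simp only [mem_filter, mem_univ, true_and, mem_insert, forall_eq_or_imp] at this
            exact this.1
          · exact h x (mem_erase.2 ⟨hxk, hx⟩)
        rw [h2, hone] at this
        exact absurd this (by decide)
      have e1 := heven _ hsub (insert_nonempty k K) hne
      have e2 := heven _ hKI hKn hKne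
      rw [card_insert_of_notMem hk]
      obtain ⟨a, ha⟩ := e1
      obtain ⟨b, hb⟩ := e2
      omega
  rcases I.eq_empty_or_nonempty with rfl | ⟨i, hi⟩
  · simp
  by_contra! hcard
  have hE : (I.erase i).Nonempty := by
    rw [← card_pos, card_erase_of_mem hi]; omega
  have hne : I.erase i ≠ I := fun h => by rw [← h] at hi; simp at hi
  -- Here the bound reads N ≤ 4 − |I|, while t = 0 and evenness give N ≥ 2.
  have h1 := key _ (erase_subset i I) hE hne
  have h2 := heven _ (erase_subset i I) hE hne
  have h3 : 0 < #{t : G | ∀ k ∈ I.erase i, k - t ∈ I} :=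
    card_pos.2 ⟨0, by simp only [mem_filter, mem_univ, true_and, sub_zero]
                      exact fun k hk => mem_of_mem_erase hk⟩
  rw [card_erase_of_mem hi] at h1
  obtain ⟨a, ha⟩ := h2
  omega

/-! ### Trace characters and orthogonality -/

section Characters

variable {F : Type*} [Field F] [Algebra (ZMod 2) F]

theorem charTwo_of_algebra (F : Type*) [Field F] [Algebra (ZMod 2) F] : CharP F 2 :=
  charP_of_injective_algebraMap (algebraMap (ZMod 2) F).injective 2

theorem binarySign_add (a b : ZMod 2) : binarySign (a + b) = binarySign a * binarySign b := by
  revert a b; decide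

theorem binarySign_eq (a : ZMod 2) : binarySign a = if a = 0 then 1 else -1 := by
  revert a; decide

theorem binarySign_mul_self (a : ZMod 2) : binarySign a * binarySign a = 1 := by
  revert a; decide

theorem absTrace_add (x y : F) : absTrace (x + y) = absTrace x + absTrace y :=
  map_add (Algebra.trace (ZMod 2) F) x y

theorem absTrace_zero : absTrace (0 : F) = 0 := map_zero (Algebra.trace (ZMod 2) F)

/-- The canonical additive character `(-1)^(tr x)`. -/
noncomputable def traceSign (x : F) : ℤ := binarySign (absTrace x)

theorem traceSign_add (x y : F) : traceSign (x + y) = traceSign x * traceSign y := by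
  rw [traceSign, absTrace_add, binarySign_add]; rfl

theorem traceSign_zero : traceSign (0 : F) = 1 := by rw [traceSign, absTrace_zero]; rfl

theorem traceSign_mul_self (x : F) : traceSign x * traceSign x = 1 := binarySign_mul_self _

theorem traceSign_eq_or (x : F) : traceSign x = 1 ∨ traceSign x = -1 := by
  rw [traceSign, binarySign_eq]; split_ifs <;> simp

theorem traceSign_eq_one_iff (x : F) : traceSign x = 1 ↔ absTrace x = 0 := by
  rw [traceSign, binarySign_eq]; split_ifs <;> simp_all

theorem traceSign_eq_neg_one_iff (x : F) : traceSign x = -1 ↔ absTrace x = 1 := by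
  rw [traceSign]; generalize absTrace x = a; revert a; decide

theorem add_self_eq_zero_of_algebra (x : F) : x + x = 0 := by
  have := charTwo_of_algebra F
  exact CharTwo.add_self_eq_zero x

theorem add_eq_zero_iff_of_algebra (x y : F) : x + y = 0 ↔ x = y := by
  have := charTwo_of_algebra F
  exact CharTwo.add_eq_zero

variable [Fintype F]

theorem absTrace_sq (x : F) : absTrace (x ^ 2) = absTrace x := by
  have := Algebra.trace_eq_of_algEquiv (FiniteField.frobeniusAlgEquivOfAlgebraic (ZMod 2) F) x
  simpa [absTrace] using this

theorem absTrace_pow_two_pow (x : F) (n : ℕ) : absTrace (x ^ 2 ^ n) = absTrace x := by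
  induction n with
  | zero => simp
  | succ n ih => rw [pow_succ, pow_mul, absTrace_sq, ih]

theorem traceSign_sq (x : F) : traceSign (x ^ 2) = traceSign x := by
  rw [traceSign, absTrace_sq]; rfl

theorem exists_absTrace_mul_eq_one {a : F} (ha : a ≠ 0) : ∃ b : F, absTrace (a * b) = 1 := by
  obtain ⟨b, hb⟩ := Algebra.trace_surjective (ZMod 2) F 1
  exact ⟨a⁻¹ * b, by rw [mul_inv_cancel_left₀ ha]; exact hb⟩

theorem sum_traceSign_mul [DecidableEq F] (a : F) :
    ∑ γ : F, traceSign (γ * a) = if a = 0 then (Fintype.card F : ℤ) else 0 := by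
  split_ifs with h
  · simp [h, traceSign_zero]
  · obtain ⟨b, hb⟩ := exists_absTrace_mul_eq_one h
    have h1 : traceSign (b * a) = -1 := (traceSign_eq_neg_one_iff _).2 (by rw [mul_comm]; exact hb)
    have h2 : ∑ γ : F, traceSign ((γ + b) * a) = ∑ γ : F, traceSign (γ * a) :=
      Fintype.sum_equiv (Equiv.addRight b) _ _ fun _ => rfl
    simp only [add_mul, traceSign_add, ← sum_mul, h1] at h2
    linarith

/-- Orthogonality keeps only pairs in a common fibre of φ. The identity map gives Parseval; the
first projection of F × F gives the fourth moment. -/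
theorem sum_sq_sum_traceSign [DecidableEq F] {X : Type*} [Fintype X] (s : X → ℤ) (φ : X → F) :
    ∑ γ : F, (∑ p, traceSign (γ * φ p) * s p) ^ 2 =
      Fintype.card F * ∑ p, ∑ p', if φ p = φ p' then s p * s p' else 0 := by
  have h : ∀ γ : F, (∑ p, traceSign (γ * φ p) * s p) ^ 2 =
      ∑ p, ∑ p', traceSign (γ * (φ p + φ p')) * (s p * s p') := by
    intro γ
    rw [sq, sum_mul_sum]
    refine sum_congr rfl fun p _ => sum_congr rfl fun p' _ => ?_
    rw [mul_add, traceSign_add]; ring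
  simp_rw [h]
  rw [sum_comm, mul_sum]
  refine sum_congr rfl fun p _ => ?_
  rw [sum_comm, mul_sum]
  refine sum_congr rfl fun p' _ => ?_
  rw [← sum_mul, sum_traceSign_mul]
  simp only [add_eq_zero_iff_of_algebra]
  split_ifs <;> simp

end Characters

/-! ### Moments of Walsh coefficients -/

section Walsh

variable {F : Type*} [Field F] [Algebra (ZMod 2) F] [Fintype F]

/-- The Walsh coefficient of the coordinate function `tr (β G)` at `γ`. -/
noncomputable def walsh (G : F → F) (β γ : F) : ℤ := ∑ x : F, traceSign (γ * x + β * G x)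

theorem walshCoeff_eq_walsh (G : F → F) (β γ : F) :
    walshCoeff (fun x => absTrace (β * G x)) γ = walsh G β γ := by
  simp only [walshCoeff, walsh, traceSign, absTrace_add]

theorem walsh_zero_left [DecidableEq F] (G : F → F) (γ : F) :
    walsh G 0 γ = if γ = 0 then (Fintype.card F : ℤ) else 0 := by
  rw [← sum_traceSign_mul γ, walsh]
  exact sum_congr rfl fun x _ => by rw [zero_mul, add_zero, mul_comm]

theorem walsh_sq (G : F → F) (β γ : F) : walsh G β γ ^ 2 =
    ∑ u : F, traceSign (γ * u) * ∑ x : F, traceSign (β * (G (x + u) + G x)) := by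
  rw [walsh, sq, sum_mul_sum]
  simp_rw [mul_sum]
  rw [sum_comm (γ := F) (s := univ) (t := univ)
    (f := fun u x => traceSign (γ * u) * traceSign (β * (G (x + u) + G x)))]
  refine sum_congr rfl fun x _ => (Fintype.sum_equiv (Equiv.addLeft x) _ _ fun u => ?_).symm
  simp only [Equiv.coe_addLeft, mul_add, traceSign_add]
  linear_combination (-traceSign (γ * u) * traceSign (β * G (x + u)) * traceSign (β * G x)) *
    traceSign_mul_self (γ * x)

theorem sum_walsh_sq [DecidableEq F] (G : F → F) (β : F) :
    ∑ γ : F, walsh G β γ ^ 2 = (Fintype.card F : ℤ) ^ 2 := by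
  have h := sum_sq_sum_traceSign (fun x => traceSign (β * G x)) (fun x : F => x)
  simp only [← traceSign_add] at h
  simp only [walsh]
  rw [h, sq]
  congr 1
  simp [traceSign_add, traceSign_mul_self]

/-- The inverse transform of the squared Walsh coefficients is the autocorrelation. -/
theorem sum_traceSign_mul_walsh_sq [DecidableEq F] (G : F → F) (β a : F) :
    ∑ γ : F, traceSign (γ * a) * walsh G β γ ^ 2 =
      Fintype.card F * ∑ x : F, traceSign (β * (G (x + a) + G x)) := by
  simp_rw [walsh_sq, mul_sum]
  rw [sum_comm]
  have : ∀ u : F, ∑ γ : F, ∑ x : F, traceSign (γ * a) *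
      (traceSign (γ * u) * traceSign (β * (G (x + u) + G x))) =
      if u = a then (Fintype.card F : ℤ) * ∑ x : F, traceSign (β * (G (x + u) + G x)) else 0 := by
    intro u
    have h : ∀ γ x : F, traceSign (γ * a) *
        (traceSign (γ * u) * traceSign (β * (G (x + u) + G x))) =
        traceSign (γ * (a + u)) * traceSign (β * (G (x + u) + G x)) := by
      intro γ x; rw [mul_add γ, traceSign_add (γ * a), mul_assoc]
    simp_rw [h, ← mul_sum, ← sum_mul]
    rw [sum_traceSign_mul]
    simp only [add_eq_zero_iff_of_algebra]
    by_cases h : u = a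
    · simp [h]
    · simp [h, Ne.symm h]
  simp_rw [mul_sum] at this
  simp_rw [this]
  simp

/-- The fourth moment is q² times the number of (u, x, y) with equal derivatives in direction u at x
and y. For u = 0 every y counts; for u ≠ 0 at least y = x and y = x + u do. This gives q(q + 2(q −
1)). -/
theorem sum_walsh_pow_four_ge [DecidableEq F] (G : F → F) :
    (Fintype.card F : ℤ) ^ 2 * (3 * (Fintype.card F : ℤ) ^ 2 - 2 * Fintype.card F) ≤
      ∑ β : F, ∑ γ : F, walsh G β γ ^ 4 := by
  set q : ℤ := (Fintype.card F : ℤ) with hq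
  have h1 : ∀ β γ : F, walsh G β γ ^ 4 = (∑ p : F × F, traceSign (γ * p.1) *
      traceSign (β * (G (p.2 + p.1) + G p.2))) ^ 2 := by
    intro β γ
    rw [show walsh G β γ ^ 4 = (walsh G β γ ^ 2) ^ 2 by ring, walsh_sq, Fintype.sum_prod_type]
    simp_rw [mul_sum]
  have h2 : ∑ β : F, ∑ γ : F, walsh G β γ ^ 4 = q ^ 2 * ∑ p : F × F, ∑ p' : F × F,
      if p.1 = p'.1 ∧ G (p.2 + p.1) + G p.2 = G (p'.2 + p'.1) + G p'.2 then 1 else 0 := by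
    simp_rw [h1, sum_sq_sum_traceSign]
    rw [← mul_sum, sq, mul_assoc]
    congr 1
    rw [sum_comm, mul_sum]
    refine sum_congr rfl fun p _ => ?_
    rw [sum_comm, mul_sum]
    refine sum_congr rfl fun p' _ => ?_
    by_cases hp : p.1 = p'.1
    · simp only [hp, if_true, true_and, ← traceSign_add, ← mul_add]
      rw [sum_traceSign_mul]
      simp only [add_eq_zero_iff_of_algebra, hq, mul_ite, mul_one, mul_zero]
    · simp [hp]
  rw [h2]
  refine mul_le_mul_of_nonneg_left ?_ (by positivity)
  have h3 : ∀ p : F × F, (if p.1 = 0 then q else 2) ≤ ∑ p' : F × F,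
      if p.1 = p'.1 ∧ G (p.2 + p.1) + G p.2 = G (p'.2 + p'.1) + G p'.2 then (1 : ℤ) else 0 := by
    rintro ⟨u, x⟩
    simp only
    rw [← Finset.sum_filter, sum_const, nsmul_eq_mul, mul_one]
    split_ifs with hu
    · subst hu
      rw [hq, Nat.cast_le, ← Finset.card_univ]
      refine card_le_card_of_injOn (fun y => ((0 : F), y)) ?_ ?_
      · intro y _
        simp [add_self_eq_zero_of_algebra]
      · intro a _ b _ h; simpa using h
    · have : 1 < #{p' : F × F | u = p'.1 ∧ G (x + u) + G x = G (p'.2 + p'.1) + G p'.2} := by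
        rw [Finset.one_lt_card]
        refine ⟨(u, x), by simp, (u, x + u), ?_, by simpa using hu⟩
        have : x + u + u = x := by rw [add_assoc, add_self_eq_zero_of_algebra, add_zero]
        simp [this, add_comm (G x)]
      exact_mod_cast this
  refine le_trans (le_of_eq ?_) (sum_le_sum fun p _ => h3 p)
  rw [Fintype.sum_prod_type]
  have h5 : ∀ u : F, ∑ _x : F, (if u = 0 then q else 2) = q * if u = 0 then q else 2 := by
    intro u; rw [sum_const, Finset.card_univ, nsmul_eq_mul]
  simp_rw [h5]
  rw [← mul_sum, ← Finset.add_sum_erase _ _ (mem_univ (0 : F)), if_pos rfl]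
  rw [sum_congr rfl (g := fun _ => (2 : ℤ)) fun x hx => if_neg (ne_of_mem_erase hx)]
  rw [sum_const, card_erase_of_mem (mem_univ _), Finset.card_univ, nsmul_eq_mul,
    Nat.cast_pred Fintype.card_pos, ← hq]
  ring

/-- If all squared Walsh coefficients are at most `2q`, they are `0` or `2q`. -/
theorem walsh_sq_eq_of_le (G : F → F)
    (h : ∀ β γ : F, β ≠ 0 → walsh G β γ ^ 2 ≤ 2 * Fintype.card F) (β γ : F) (hβ : β ≠ 0) :
    walsh G β γ ^ 2 = 0 ∨ walsh G β γ ^ 2 = 2 * Fintype.card F := by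
  classical
  set q : ℤ := (Fintype.card F : ℤ) with hq
  have hnn : ∀ β ∈ univ.erase (0 : F), ∀ γ ∈ (univ : Finset F),
      0 ≤ walsh G β γ ^ 2 * (2 * q - walsh G β γ ^ 2) := fun β hβ γ _ =>
    mul_nonneg (sq_nonneg _) (sub_nonneg.2 (h β γ (ne_of_mem_erase hβ)))
  have h4 := sum_walsh_pow_four_ge G
  rw [← Finset.add_sum_erase _ _ (mem_univ (0 : F))] at h4
  have h0 : ∑ γ : F, walsh G 0 γ ^ 4 = q ^ 4 := by
    simp_rw [walsh_zero_left]
    simp [hq]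
  -- By Parseval and the fourth-moment bound the sum is at most 2q·(q − 1)q² − (3q⁴ − 2q³ − q⁴) = 0,
  -- so all its nonnegative terms vanish.
  have hsum : ∑ β ∈ univ.erase (0 : F), ∑ γ : F,
      walsh G β γ ^ 2 * (2 * q - walsh G β γ ^ 2) ≤ 0 := by
    have e : ∑ β ∈ univ.erase (0 : F), ∑ γ : F,
        walsh G β γ ^ 2 * (2 * q - walsh G β γ ^ 2) =
        2 * q * ∑ β ∈ univ.erase (0 : F), ∑ γ : F, walsh G β γ ^ 2 -
        ∑ β ∈ univ.erase (0 : F), ∑ γ : F, walsh G β γ ^ 4 := by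
      simp_rw [mul_sum, ← sum_sub_distrib]
      exact sum_congr rfl fun _ _ => sum_congr rfl fun _ _ => by ring
    rw [e]
    simp_rw [sum_walsh_sq]
    rw [sum_const, card_erase_of_mem (mem_univ _), Finset.card_univ, nsmul_eq_mul,
      Nat.cast_pred Fintype.card_pos, ← hq]
    rw [h0, ← hq] at h4
    nlinarith [h4]
  have hz := (sum_eq_zero_iff_of_nonneg fun β hβ => sum_nonneg (hnn β hβ)).1
    (le_antisymm hsum (sum_nonneg fun β hβ => sum_nonneg (hnn β hβ)))
  have hβ' : β ∈ univ.erase (0 : F) := mem_erase.2 ⟨hβ, mem_univ _⟩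
  have := (sum_eq_zero_iff_of_nonneg (hnn β hβ')).1 (hz β hβ') γ (mem_univ _)
  rcases mul_eq_zero.1 this with h | h
  · exact Or.inl h
  · exact Or.inr (by linarith)

theorem natAbs_walsh_le_vectLinearity (G : F → F) (β γ : F) (hβ : β ≠ 0) :
    (walsh G β γ).natAbs ≤ vectLinearity G := by
  classical
  rw [← walshCoeff_eq_walsh]
  refine le_trans ?_ (Finset.le_sup (f := fun β => boolLinearity fun x => absTrace (β * G x))
    (mem_filter.2 ⟨mem_univ β, hβ⟩))
  exact Finset.le_sup (f := fun γ => (walshCoeff (fun x => absTrace (β * G x)) γ).natAbs)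
    (mem_univ γ)

theorem IsMaximumNonlinear.walsh_sq_eq {G : F → F} (hG : IsMaximumNonlinear G) (β γ : F)
    (hβ : β ≠ 0) : walsh G β γ ^ 2 = 0 ∨ walsh G β γ ^ 2 = 2 * Fintype.card F := by
  refine walsh_sq_eq_of_le G (fun β γ hβ => ?_) β γ hβ
  obtain ⟨⟨n, hn⟩, h⟩ := hG
  have h1 := natAbs_walsh_le_vectLinearity G β γ hβ
  have hc : Fintype.card F = 2 ^ (2 * n + 1) := by
    have := Module.card_eq_pow_finrank (K := ZMod 2) (V := F)
    rwa [hn, ZMod.card] at this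
  rw [h, hn, show (2 * n + 1 + 1) / 2 = n + 1 by omega] at h1
  have h2 := Nat.pow_le_pow_left h1 2
  rw [← Int.natAbs_sq, hc]
  have h3 : (2 ^ (n + 1)) ^ 2 = 2 * 2 ^ (2 * n + 1) := by ring
  rw [h3] at h2
  exact_mod_cast h2

end Walsh

/-! ### Almost bent power functions are permutations -/

section PowerWalsh

variable {F : Type*} [Field F] [Algebra (ZMod 2) F] [Fintype F]

theorem sum_walsh_zero_right [DecidableEq F] {d : ℕ} (hd : d ≠ 0) :
    ∑ β : F, walsh (fun x : F => x ^ d) β 0 = Fintype.card F := by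
  simp only [walsh, zero_mul, zero_add]
  rw [sum_comm]
  simp_rw [sum_traceSign_mul]
  simp [hd]

/-- If a Walsh coefficient of `x ^ d` at zero vanishes, then `x ^ d` is a permutation. -/
theorem pow_injective_of_walsh_eq_zero {d : ℕ} (hd : d ≠ 0) {β : F}
    (h : walsh (fun x : F => x ^ d) β 0 = 0) : Function.Injective fun x : F => x ^ d := by
  classical
  set φ : Fˣ →* Fˣ := powMonoidHom d with hφ
  set n := #{g : Fˣ | φ g = 1} with hn
  have hfib : ∀ y ∈ univ.image φ, #{g : Fˣ | φ g = y} = n := by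
    intro y hy
    obtain ⟨x, -, rfl⟩ := mem_image.1 hy
    exact MonoidHom.card_fiber_eq_of_mem_range φ ⟨x, rfl⟩ ⟨1, map_one φ⟩
  have hsum : ∑ x : Fˣ, traceSign (β * (x : F) ^ d) =
      (n : ℤ) * ∑ y ∈ univ.image φ, traceSign (β * (y : F)) := by
    rw [← sum_fiberwise_of_maps_to (s := univ) (t := univ.image φ) (g := φ)
      (fun x _ => mem_image_of_mem φ (mem_univ x)), mul_sum]
    refine sum_congr rfl fun y hy => ?_
    rw [sum_congr rfl (g := fun _ => traceSign (β * (y : F)))]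
    · rw [sum_const, hfib y hy, nsmul_eq_mul]
    · intro x hx
      rw [← (mem_filter.1 hx).2]; simp [hφ]
  have hsplit : walsh (fun x : F => x ^ d) β 0 = 1 + ∑ x : Fˣ, traceSign (β * (x : F) ^ d) := by
    rw [walsh, ← Finset.add_sum_erase _ _ (mem_univ (0 : F))]
    simp only [zero_mul, zero_add, zero_pow hd, mul_zero, traceSign_zero]
    congr 1
    symm
    refine sum_bij (fun x _ => (x : F)) (fun x _ => by simp) (fun a _ b _ h => Units.ext h) ?_
      fun _ _ => rfl
    intro b hb
    exact ⟨Units.mk0 b (ne_of_mem_erase hb), mem_univ _, rfl⟩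
  -- All nonempty fibres of the power map on units have n elements, so the coefficient is 1 plus a
  -- multiple of n.
  have hdvd : (n : ℤ) ∣ 1 := by
    rw [h, hsum] at hsplit
    exact ⟨-∑ y ∈ univ.image φ, traceSign (β * (y : F)), by linarith⟩
  have hn1 : n = 1 := Nat.dvd_one.1 (by exact_mod_cast hdvd)
  intro x y hxy
  simp only at hxy
  by_cases hy : y = 0
  · subst hy
    rw [zero_pow hd] at hxy
    exact eq_zero_of_pow_eq_zero hxy
  have hx : x ≠ 0 := by
    rintro rfl
    rw [zero_pow hd] at hxy
    exact hy (eq_zero_of_pow_eq_zero hxy.symm)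
  obtain ⟨z, hz⟩ := card_eq_one.1 (hn.symm.trans hn1)
  have h1 : (1 : Fˣ) ∈ ({g : Fˣ | φ g = 1} : Finset Fˣ) := by simp
  have h2 : (Units.mk0 x hx * (Units.mk0 y hy)⁻¹) ∈ ({g : Fˣ | φ g = 1} : Finset Fˣ) := by
    simp only [mem_filter, mem_univ, true_and, hφ, powMonoidHom_apply]
    ext
    simp [mul_pow, hxy, hy]
  rw [hz, mem_singleton] at h1 h2
  rw [← h1, mul_inv_eq_one] at h2
  exact congrArg Units.val h2

theorem traceSign_one (hm : Odd (Module.finrank (ZMod 2) F)) : traceSign (1 : F) = -1 := by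
  rw [traceSign_eq_neg_one_iff, absTrace, ← map_one (algebraMap (ZMod 2) F),
    Algebra.trace_algebraMap]
  obtain ⟨n, hn⟩ := hm
  rw [hn]
  simp only [nsmul_eq_mul, mul_one]
  push_cast
  have : (2 : ZMod 2) = 0 := rfl
  rw [this]; ring

theorem card_eq_two_pow_finrank : Fintype.card F = 2 ^ Module.finrank (ZMod 2) F := by
  have := Module.card_eq_pow_finrank (K := ZMod 2) (V := F)
  rwa [ZMod.card] at this

namespace IsMaximumNonlinear

variable {d : ℕ}

theorem exponent_ne_zero (hd : IsMaximumNonlinear fun x : F => x ^ d)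
    (h2 : 2 < Fintype.card F) : d ≠ 0 := by
  rintro rfl
  have h := hd.walsh_sq_eq 1 0 one_ne_zero
  have e : walsh (fun x : F => x ^ 0) 1 0 = -(Fintype.card F : ℤ) := by
    simp [walsh, traceSign_one hd.1]
  rw [e] at h
  have : (2 : ℤ) < Fintype.card F := by exact_mod_cast h2
  rcases h with h | h <;> nlinarith

/-- The coefficients at γ = 0 with β ≠ 0 sum to zero. If none vanished, each would be ±2^(n+1), and
a sum of q − 1 signs is odd. -/
theorem exists_walsh_eq_zero (hd : IsMaximumNonlinear fun x : F => x ^ d)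
    (h2 : 2 < Fintype.card F) :
    ∃ β : F, walsh (fun x : F => x ^ d) β 0 = 0 := by
  classical
  by_contra! hne
  have hs := sum_walsh_zero_right (F := F) (hd.exponent_ne_zero h2)
  rw [← Finset.add_sum_erase _ _ (mem_univ (0 : F)), walsh_zero_left, if_pos rfl] at hs
  have hs0 : ∑ β ∈ univ.erase (0 : F), walsh (fun x : F => x ^ d) β 0 = 0 := by linarith
  obtain ⟨n, hn⟩ := hd.1
  have hc : (Fintype.card F : ℤ) = 2 ^ (2 * n + 1) := by
    rw [card_eq_two_pow_finrank, hn]; push_cast; rfl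
  have hv : ∀ β ∈ univ.erase (0 : F), ∃ s : ℤ, Odd s ∧
      walsh (fun x : F => x ^ d) β 0 = 2 ^ (n + 1) * s := by
    intro β hβ
    rcases hd.walsh_sq_eq β 0 (ne_of_mem_erase hβ) with h | h
    · exact absurd (pow_eq_zero_iff two_ne_zero |>.1 h) (hne β)
    · have : walsh (fun x : F => x ^ d) β 0 ^ 2 = (2 ^ (n + 1) : ℤ) ^ 2 := by
        rw [h, hc]; ring
      rcases sq_eq_sq_iff_eq_or_eq_neg.1 this with h | h
      · exact ⟨1, odd_one, by rw [h, mul_one]⟩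
      · exact ⟨-1, odd_one.neg, by rw [h]; ring⟩
  choose! s hs1 hs2 using hv
  rw [sum_congr rfl hs2, ← mul_sum, mul_eq_zero, or_iff_right (by positivity)] at hs0
  have hodd : Odd (∑ β ∈ univ.erase (0 : F), s β) := by
    have e : ∑ β ∈ univ.erase (0 : F), s β =
        ∑ β ∈ univ.erase (0 : F), (s β - 1) + (2 ^ (2 * n + 1) - 1) := by
      rw [sum_sub_distrib, sum_const, card_erase_of_mem (mem_univ _), Finset.card_univ,
        nsmul_eq_mul, Nat.cast_pred Fintype.card_pos, hc]
      ring
    rw [e]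
    exact (Finset.even_sum _ fun β hβ => (hs1 β hβ).sub_odd odd_one).add_odd
      ((even_two.pow_of_ne_zero (by omega)).sub_odd odd_one)
  rw [hs0] at hodd
  exact absurd hodd (by decide)

theorem pow_injective (hd : IsMaximumNonlinear fun x : F => x ^ d)
    (h2 : 2 < Fintype.card F) : Function.Injective fun x : F => x ^ d := by
  obtain ⟨β, hβ⟩ := hd.exists_walsh_eq_zero h2
  exact pow_injective_of_walsh_eq_zero (hd.exponent_ne_zero h2) hβ

theorem walsh_one_zero (hd : IsMaximumNonlinear fun x : F => x ^ d)
    (h2 : 2 < Fintype.card F) : walsh (fun x : F => x ^ d) 1 0 = 0 := by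
  classical
  have hb : Function.Bijective fun x : F => x ^ d :=
    Finite.injective_iff_bijective.1 (hd.pow_injective h2)
  have h := sum_traceSign_mul (1 : F)
  rw [if_neg one_ne_zero, ← hb.sum_comp] at h
  simpa [walsh] using h

end IsMaximumNonlinear

/-! ### Walsh support and linear structures -/

theorem walsh_frobenius (d : ℕ) (γ : F) :
    walsh (fun x : F => x ^ d) 1 (γ ^ 2) = walsh (fun x : F => x ^ d) 1 γ := by
  have := charTwo_of_algebra F
  have hb : Function.Bijective fun x : F => x ^ 2 :=
    Finite.injective_iff_bijective.1 CharTwo.sq_injective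
  rw [walsh, ← hb.sum_comp]
  refine sum_congr rfl fun x _ => ?_
  rw [← traceSign_sq (γ * x + 1 * x ^ d)]
  congr 1
  rw [CharTwo.add_sq]; ring

/-- A max nonlinear power function whose trace changes by one under `x ↦ x + 1` has Walsh
support `{γ | tr γ = 1}`. -/
theorem walsh_sq_of_linear_structure {d : ℕ} (hd : IsMaximumNonlinear fun x : F => x ^ d)
    (h : ∀ x : F, traceSign ((x + 1) ^ d + x ^ d) = -1) (γ : F) :
    walsh (fun x : F => x ^ d) 1 γ ^ 2 = Fintype.card F * (1 - traceSign γ) := by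
  classical
  -- If tr γ = 0, the shift x ↦ x + 1 negates the coefficient; otherwise the bound is 2q. By
  -- Parseval both sides have the same total, so equality holds everywhere.
  have hle : ∀ γ ∈ (univ : Finset F), walsh (fun x : F => x ^ d) 1 γ ^ 2 ≤
      Fintype.card F * (1 - traceSign γ) := by
    intro γ _
    rcases traceSign_eq_or γ with hγ | hγ
    · have : walsh (fun x : F => x ^ d) 1 γ = -walsh (fun x : F => x ^ d) 1 γ := by
        conv_lhs => rw [walsh, ← Equiv.sum_comp (Equiv.addRight (1 : F))]
        rw [walsh, ← sum_neg_distrib]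
        refine sum_congr rfl fun x _ => ?_
        have hx := h x
        simp only [Equiv.coe_addRight, one_mul, mul_add, mul_one, traceSign_add, hγ] at hx ⊢
        linear_combination traceSign (γ * x) * traceSign (x ^ d) * hx -
          traceSign (γ * x) * traceSign ((x + 1) ^ d) * traceSign_mul_self (x ^ d)
      have : walsh (fun x : F => x ^ d) 1 γ = 0 := by linarith
      rw [this, hγ]; simp
    · rw [hγ]
      have : (0 : ℤ) ≤ Fintype.card F := by positivity
      rcases hd.walsh_sq_eq 1 γ one_ne_zero with h | h <;> rw [h] <;> linarith
  refine (sum_eq_sum_iff_of_le hle).1 ?_ γ (mem_univ γ)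
  rw [sum_walsh_sq, ← mul_sum, sum_sub_distrib]
  have := sum_traceSign_mul (1 : F)
  rw [if_neg one_ne_zero] at this
  simp only [mul_one] at this
  rw [this]
  simp [sq]

/-- Nondegeneracy of the trace form gives ψ = tr(c ·), and Frobenius invariance forces c² = c.
Parseval excludes c = 0. -/
theorem walsh_sq_of_additive_support {d : ℕ} (hd : IsMaximumNonlinear fun x : F => x ^ d)
    (ψ : F →+ ZMod 2) (hψ : ∀ γ, ψ γ = 0 ↔ walsh (fun x : F => x ^ d) 1 γ = 0) (γ : F) :
    walsh (fun x : F => x ^ d) 1 γ ^ 2 = Fintype.card F * (1 - traceSign γ) := by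
  classical
  have hlin : ∃ c : F, ∀ γ, ψ γ = absTrace (c * γ) := by
    let L : F →ₗ[ZMod 2] ZMod 2 := ψ.toZModLinearMap 2
    have hnd := traceForm_nondegenerate (ZMod 2) F
    refine ⟨(LinearMap.BilinForm.toDual _ hnd).symm L, fun γ => ?_⟩
    have := LinearMap.BilinForm.apply_toDual_symm_apply (hB := hnd) L γ
    rw [Algebra.traceForm_apply] at this
    exact this.symm
  obtain ⟨c, hc⟩ := hlin
  have hfrob : ∀ γ, ψ (γ ^ 2) = ψ γ := by
    intro γ
    have h1 := hψ γ
    have h2 := hψ (γ ^ 2)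
    rw [walsh_frobenius, ← h1] at h2
    revert h2
    generalize ψ γ = a
    generalize ψ (γ ^ 2) = b
    revert a b; decide
  have hcc : c ^ 2 = c := by
    by_contra hne
    rw [← add_eq_zero_iff_of_algebra] at hne
    obtain ⟨b, hb⟩ := exists_absTrace_mul_eq_one hne
    have := charTwo_of_algebra F
    obtain ⟨r, rfl⟩ : ∃ r : F, r ^ 2 = b :=
      (Finite.injective_iff_surjective.1 CharTwo.sq_injective) b
    have h1 := hfrob r
    rw [hc, hc, ← absTrace_sq (c * r), mul_pow] at h1
    rw [add_mul, absTrace_add, h1, CharTwo.add_self_eq_zero] at hb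
    exact absurd hb (by decide)
  have hq : (0 : ℤ) < Fintype.card F := by exact_mod_cast Fintype.card_pos
  have hc1 : c = 1 := by
    have : c * (c - 1) = 0 := by linear_combination hcc
    rcases mul_eq_zero.1 this with h | h
    · exfalso
      have hz : ∀ γ, walsh (fun x : F => x ^ d) 1 γ = 0 := fun γ => by
        rw [← hψ, hc, h, zero_mul, absTrace_zero]
      have hs := sum_walsh_sq (fun x : F => x ^ d) 1
      simp only [hz] at hs
      exact (pow_pos hq 2).ne (by simpa using hs)
    · exact sub_eq_zero.1 h
  subst hc1
  have h := hψ γ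
  rw [hc, one_mul, ← traceSign_eq_one_iff] at h
  rcases traceSign_eq_or γ with h1 | h1
  · rw [h.1 h1, h1]; simp
  · have : walsh (fun x : F => x ^ d) 1 γ ^ 2 ≠ 0 := by
      rw [Ne, pow_eq_zero_iff two_ne_zero, ← h, h1]; decide
    rw [(hd.walsh_sq_eq 1 γ one_ne_zero).resolve_left this, h1]; ring

theorem sum_autocorrelation [DecidableEq F] {d : ℕ}
    (h : ∀ γ : F, walsh (fun x : F => x ^ d) 1 γ ^ 2 = Fintype.card F * (1 - traceSign γ))
    (a : F) : ∑ x : F, traceSign ((x + a) ^ d + x ^ d) =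
      (if a = 0 then (Fintype.card F : ℤ) else 0) - if a = 1 then (Fintype.card F : ℤ) else 0 := by
  have hq : (Fintype.card F : ℤ) ≠ 0 := by exact_mod_cast Fintype.card_ne_zero
  have h1 := sum_traceSign_mul_walsh_sq (fun x : F => x ^ d) 1 a
  simp only [h, one_mul] at h1
  refine mul_left_cancel₀ hq ?_
  rw [← h1]
  have h2 : ∀ γ : F, traceSign (γ * a) * (Fintype.card F * (1 - traceSign γ)) =
      Fintype.card F * (traceSign (γ * a) - traceSign (γ * (a + 1))) := by
    intro γ; rw [mul_add, traceSign_add, mul_one]; ring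
  simp_rw [h2, ← mul_sum, sum_sub_distrib, sum_traceSign_mul, add_eq_zero_iff_of_algebra]

/-- The autocorrelation at 1 is −q, the least possible sum of q signs. -/
theorem linear_structure_of_walsh_sq {d : ℕ}
    (h : ∀ γ : F, walsh (fun x : F => x ^ d) 1 γ ^ 2 = Fintype.card F * (1 - traceSign γ))
    (x : F) : traceSign ((x + 1) ^ d + x ^ d) = -1 := by
  classical
  have h1 := sum_autocorrelation h 1
  rw [if_neg one_ne_zero, if_pos rfl, zero_sub] at h1
  refine ((sum_eq_sum_iff_of_le (s := univ) (f := fun _ : F => (-1 : ℤ))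
    (g := fun x => traceSign ((x + 1) ^ d + x ^ d)) (fun x _ => ?_)).1 ?_ x (mem_univ x)).symm
  · rcases traceSign_eq_or ((x + 1) ^ d + x ^ d) with h | h <;> simp [h]
  · rw [h1]; simp

/-- A constant derivative would give autocorrelation ±q, but it is 0 away from 0 and 1. -/
theorem not_const_autocorrelation {d : ℕ}
    (h : ∀ γ : F, walsh (fun x : F => x ^ d) 1 γ ^ 2 = Fintype.card F * (1 - traceSign γ))
    {a : F} (h0 : a ≠ 0) (h1 : a ≠ 1) (c : F) :
    ∃ x : F, traceSign ((x + a) ^ d + x ^ d) ≠ traceSign c := by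
  classical
  by_contra! hc
  have h2 := sum_autocorrelation h a
  rw [if_neg h0, if_neg h1] at h2
  simp only [hc] at h2
  rcases traceSign_eq_or c with h | h <;> simp [h] at h2

end PowerWalsh

/-! ### Intersection sizes in terms of Walsh coefficients -/

section Intersections

variable {F : Type*} [Field F] [Algebra (ZMod 2) F] [Fintype F]

/-- Each of the three conditions has indicator (1 ± character)/2. The purely linear character sums
vanish since α, β and α + β are nonzero. -/
theorem eight_mul_ncard_inter {d : ℕ} (h0 : walsh (fun x : F => x ^ d) 1 0 = 0) {α β : F}
    (hα : α ≠ 0) (hβ : β ≠ 0) (hαβ : α ≠ β) (i j : ZMod 2) :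
    8 * ((codimTwoSet i j α β ∩ powerTraceSet F d).ncard : ℤ) = Fintype.card F -
      (binarySign i * walsh (fun x : F => x ^ d) 1 α +
        binarySign j * walsh (fun x : F => x ^ d) 1 β +
        binarySign i * binarySign j * walsh (fun x : F => x ^ d) 1 (α + β)) := by
  classical
  have hz : ∀ a : F, a ≠ 0 → ∑ x : F, traceSign (a * x) = 0 := by
    intro a ha
    have := sum_traceSign_mul a
    rw [if_neg ha] at this
    simpa only [mul_comm] using this
  have key : ∀ a b c : ZMod 2, (8 * if (a = i ∧ b = j) ∧ c = 1 then (1 : ℤ) else 0) =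
      (1 + binarySign i * binarySign a) * (1 + binarySign j * binarySign b) *
        (1 - binarySign c) := by
    revert i j; decide
  have hn : ((codimTwoSet i j α β ∩ powerTraceSet F d).ncard : ℤ) = ∑ x : F,
      if (absTrace (α * x) = i ∧ absTrace (β * x) = j) ∧ absTrace (x ^ d) = 1
        then (1 : ℤ) else 0 := by
    rw [← Finset.sum_filter, sum_const, nsmul_eq_mul, mul_one, ← Set.ncard_coe_finset]
    congr 2
    ext x
    simp [codimTwoSet, powerTraceSet]
  rw [hn, mul_sum]
  simp_rw [key]
  have expand : ∀ x : F, (1 + binarySign i * binarySign (absTrace (α * x))) *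
      (1 + binarySign j * binarySign (absTrace (β * x))) * (1 - binarySign (absTrace (x ^ d))) =
      1 + binarySign i * traceSign (α * x) + binarySign j * traceSign (β * x) +
      binarySign i * binarySign j * traceSign ((α + β) * x) -
      (traceSign (0 * x + 1 * x ^ d) + binarySign i * traceSign (α * x + 1 * x ^ d) +
        binarySign j * traceSign (β * x + 1 * x ^ d) +
        binarySign i * binarySign j * traceSign ((α + β) * x + 1 * x ^ d)) := by
    intro x
    simp only [traceSign_add, add_mul, one_mul, zero_mul, traceSign_zero]
    simp only [traceSign]
    ring
  simp_rw [expand]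
  simp only [sum_add_distrib, sum_sub_distrib, ← mul_sum]
  rw [hz α hα, hz β hβ, hz (α + β) (mt (add_eq_zero_iff_of_algebra α β).1 hαβ)]
  simp only [← walsh.eq_1 (fun x : F => x ^ d)]
  rw [h0]
  simp

/-- For a maximum nonlinear power function, the intersection condition describes the Walsh
support of its trace. -/
theorem hasQuadricIntersections_iff_walsh_sq {d n : ℕ} (hF : Fintype.card F = 2 ^ (2 * n + 3))
    (hd : IsMaximumNonlinear fun x : F => x ^ d) :
    HasQuadricIntersections F (2 * n + 3) d ↔
      ∀ γ : F, walsh (fun x : F => x ^ d) 1 γ ^ 2 = Fintype.card F * (1 - traceSign γ) := by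
  have h2 : 2 < Fintype.card F := by
    rw [hF, pow_add]
    have := Nat.one_le_two_pow (n := 2 * n)
    omega
  have h0 := hd.walsh_one_zero h2
  have hpos : (0 : ℤ) < 2 ^ n := by positivity
  have hcard : (Fintype.card F : ℤ) = 8 * 2 ^ (2 * n) := by rw [hF, pow_add]; push_cast; ring
  have hw : ∀ γ : F, ∃ w : ℤ, (w = 0 ∨ w = 1 ∨ w = -1) ∧
      walsh (fun x : F => x ^ d) 1 γ = 4 * 2 ^ n * w := by
    intro γ
    rcases hd.walsh_sq_eq 1 γ one_ne_zero with h | h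
    · exact ⟨0, Or.inl rfl, by rw [mul_zero]; exact pow_eq_zero_iff two_ne_zero |>.1 h⟩
    · have : walsh (fun x : F => x ^ d) 1 γ ^ 2 = (4 * 2 ^ n : ℤ) ^ 2 := by
        rw [h, hcard]; ring
      rcases sq_eq_sq_iff_eq_or_eq_neg.1 this with h | h
      · exact ⟨1, by simp, by rw [h, mul_one]⟩
      · exact ⟨-1, by simp, by rw [h]; ring⟩
  choose w hw1 hw2 using hw
  have hN : ∀ α β : F, α ≠ 0 → β ≠ 0 → α ≠ β → ∀ i j : ZMod 2,
      2 * ((codimTwoSet i j α β ∩ powerTraceSet F d).ncard : ℤ) = 2 * 2 ^ (2 * n) -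
        2 ^ n * (binarySign i * w α + binarySign j * w β +
          binarySign i * binarySign j * w (α + β)) := by
    intro α β hα hβ hαβ i j
    have := eight_mul_ncard_inter h0 hα hβ hαβ i j
    rw [hw2, hw2, hw2, hcard] at this
    linarith
  have hw0 : w 0 = 0 := by
    have := hw2 0
    rw [h0] at this
    rcases mul_eq_zero.1 this.symm with h | h
    · linarith
    · exact h
  have hexp : (2 * n + 3 - 3) / 2 = n := by omega
  constructor
  · intro h
    -- The three allowed sizes correspond to the sum being 0, −2, 2. The case i = j = 0 already
    -- makes w mod 2 additive.
    have hadd : ∀ α β : F, Even (w α + w β + w (α + β)) := by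
      intro α β
      by_cases hα : α = 0
      · subst hα; rw [hw0, zero_add, zero_add]; exact ⟨_, rfl⟩
      by_cases hβ : β = 0
      · subst hβ; rw [hw0, add_zero, add_zero]; exact ⟨_, rfl⟩
      by_cases hαβ : α = β
      · subst hαβ; rw [add_self_eq_zero_of_algebra, hw0, add_zero]; exact ⟨_, rfl⟩
      have h1 := hN α β hα hβ hαβ 0 0
      have h3 := h α β hα hβ hαβ 0 0
      rw [hexp, Nat.add_sub_cancel] at h3
      simp only [Set.mem_insert_iff, Set.mem_singleton_iff] at h3
      have e0 : binarySign 0 = 1 := by decide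
      simp only [e0, one_mul] at h1
      rcases h3 with h3 | h3 | h3 <;> rw [h3] at h1
      · have : w α + w β + w (α + β) = 0 := mul_left_cancel₀ hpos.ne' (by linarith)
        rw [this]; decide
      · have : w α + w β + w (α + β) = -2 := mul_left_cancel₀ hpos.ne' (by linarith)
        rw [this]; decide
      · have : w α + w β + w (α + β) = 2 := mul_left_cancel₀ hpos.ne' (by linarith)
        rw [this]; decide
    let ψ : F →+ ZMod 2 := AddMonoidHom.mk' (fun γ => (w γ : ZMod 2)) (by
      intro α β
      have := (ZMod.intCast_zmod_eq_zero_iff_dvd _ 2).2 (even_iff_two_dvd.1 (hadd α β))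
      push_cast at this
      rw [CharTwo.add_eq_zero] at this
      exact this.symm)
    refine walsh_sq_of_additive_support hd ψ fun γ => ?_
    rw [hw2]
    change (w γ : ZMod 2) = 0 ↔ _
    rcases hw1 γ with h | h | h <;> simp [h]
  · intro h α β hα hβ hαβ i j
    have hpar : ∀ γ, Even (w γ + (absTrace γ).val) := by
      intro γ
      have h1 := h γ
      rw [hw2, hcard] at h1
      have hp : (0 : ℤ) < 8 * 2 ^ (2 * n) := by positivity
      have h3 : 2 * w γ ^ 2 = 1 - traceSign γ := by
        refine mul_left_cancel₀ hp.ne' ?_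
        rw [← h1, mul_comm 2 n, pow_mul]; ring
      rw [traceSign, binarySign_eq] at h3
      have h4 : ((absTrace γ).val : ℤ) = if absTrace γ = 0 then 0 else 1 := by
        generalize absTrace γ = a
        revert a; decide
      rw [h4]
      split_ifs at h3 ⊢
      · have : w γ = 0 := by nlinarith
        rw [this]; decide
      · rcases hw1 γ with h | h | h <;> rw [h] at h3 ⊢
        · norm_num at h3
        · decide
        · decide
    have h1 := hN α β hα hβ hαβ i j
    rw [hexp, Nat.add_sub_cancel]
    have hsum : Even (w α + w β + w (α + β)) := by
      have e1 := ((hpar α).add (hpar β)).add (hpar (α + β))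
      rw [absTrace_add] at e1
      have e2 : ∀ a b : ZMod 2, Even ((a.val : ℤ) + b.val + (a + b).val) := by decide
      have e3 := e1.sub (e2 (absTrace α) (absTrace β))
      have e4 : w α + w β + w (α + β) = w α + (absTrace α).val + (w β + (absTrace β).val) +
          (w (α + β) + (absTrace α + absTrace β).val) -
          ((absTrace α).val + (absTrace β).val + (absTrace α + absTrace β).val) := by ring
      rw [e4]
      exact e3
    -- Signs do not affect parity, and an even sum of three terms from {0, ±1} lies in {0, ±2}.
    have hS : ∃ e : ℤ, (e = 0 ∨ e = 1 ∨ e = -1) ∧ binarySign i * w α + binarySign j * w β +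
        binarySign i * binarySign j * w (α + β) = -2 * e := by
      have s1 : binarySign i = 1 ∨ binarySign i = -1 := by rw [binarySign_eq]; split_ifs <;> simp
      have s2 : binarySign j = 1 ∨ binarySign j = -1 := by rw [binarySign_eq]; split_ifs <;> simp
      obtain ⟨k, hk⟩ := hsum
      have a1 := hw1 α
      have a2 := hw1 β
      have a3 := hw1 (α + β)
      rcases s1 with s1 | s1 <;> rcases s2 with s2 | s2 <;> rw [s1, s2]
      · exact ⟨-k, by omega, by omega⟩
      · exact ⟨-(k - w β - w (α + β)), by omega, by omega⟩
      · exact ⟨-(k - w α - w (α + β)), by omega, by omega⟩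
      · exact ⟨-(k - w α - w β), by omega, by omega⟩
    obtain ⟨e, he, hS⟩ := hS
    rw [hS] at h1
    have h3 : ((codimTwoSet i j α β ∩ powerTraceSet F d).ncard : ℤ) = 2 ^ (2 * n) + 2 ^ n * e := by
      linarith
    rw [h3]
    rcases he with rfl | rfl | rfl <;> simp [sub_eq_add_neg]

end Intersections

/-! ### Exponents as sets of binary digits modulo m -/

section BinaryExpansion

variable {m : ℕ}

/-- The natural number whose binary digits are indexed by `K`. -/
def binaryExponent (K : Finset (ZMod m)) : ℕ := ∑ k ∈ K, 2 ^ k.val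

theorem prod_pow_two_pow_val {F : Type*} [Field F] (K : Finset (ZMod m)) (x : F) :
    ∏ k ∈ K, x ^ 2 ^ k.val = x ^ binaryExponent K := by
  rw [binaryExponent, prod_pow_eq_pow_sum]

theorem finrank_eq_of_card {F : Type*} [Field F] [Fintype F] [Algebra (ZMod 2) F]
    (hF : Fintype.card F = 2 ^ m) :
    Module.finrank (ZMod 2) F = m := by
  rw [card_eq_two_pow_finrank] at hF
  exact Nat.pow_right_injective le_rfl hF

theorem exists_binaryExponent_eq {d : ℕ} (hd : d < 2 ^ m) :
    ∃ I : Finset (ZMod m), binaryExponent I = d := by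
  have hlt : ∀ i ∈ d.bitIndices.toFinset, i < m := fun i hi =>
    (Nat.pow_lt_pow_iff_right one_lt_two).1
      ((Nat.two_pow_le_of_mem_bitIndices (List.mem_toFinset.1 hi)).trans_lt hd)
  refine ⟨d.bitIndices.toFinset.image (Nat.cast : ℕ → ZMod m), ?_⟩
  rw [binaryExponent, sum_image (g := (Nat.cast : ℕ → ZMod m))]
  · conv_rhs => rw [← Finset.sum_toFinset_bitIndices_two_pow d]
    refine sum_congr rfl fun i hi => ?_
    rw [ZMod.val_cast_of_lt (hlt i hi)]
  · intro a ha b hb h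
    have := congrArg ZMod.val h
    rwa [ZMod.val_cast_of_lt (hlt a ha), ZMod.val_cast_of_lt (hlt b hb)] at this

theorem pow_two_pow_mod {F : Type*} [Field F] [Fintype F] (hF : Fintype.card F = 2 ^ m)
    (x : F) (n : ℕ) :
    x ^ 2 ^ (n % m) = x ^ 2 ^ n := by
  conv_rhs => rw [← Nat.div_add_mod n m, pow_add, pow_mul, pow_mul 2 m, ← hF,
    FiniteField.pow_card_pow]

variable [NeZero m]

theorem binaryExponent_eq_sum_image (K : Finset (ZMod m)) :
    binaryExponent K = ∑ i ∈ K.image ZMod.val, 2 ^ i := by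
  rw [sum_image ((ZMod.val_injective m).injOn), binaryExponent]

theorem binaryExponent_lt (K : Finset (ZMod m)) : binaryExponent K < 2 ^ m := by
  rw [binaryExponent_eq_sum_image]
  refine Nat.geomSum_lt le_rfl fun k hk => ?_
  obtain ⟨a, -, rfl⟩ := mem_image.1 hk
  exact ZMod.val_lt a

theorem binaryExponent_injective :
    Function.Injective (binaryExponent : Finset (ZMod m) → ℕ) := by
  intro K L h
  rw [binaryExponent_eq_sum_image, binaryExponent_eq_sum_image] at h
  exact image_injective (ZMod.val_injective m) (Finset.geomSum_injective le_rfl h)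

variable {F : Type*} [Field F] [Fintype F]

/-- The monomials with exponents below `q` are linearly independent as functions. -/
theorem coeff_eq_zero_of_sum_monomials_eq_zero (hF : Fintype.card F = 2 ^ m)
    (c : Finset (ZMod m) → F) (h : ∀ x : F, ∑ K, c K * x ^ binaryExponent K = 0)
    (K : Finset (ZMod m)) : c K = 0 := by
  set p : Polynomial F := ∑ K, Polynomial.C (c K) * Polynomial.X ^ binaryExponent K with hp
  have hdeg : p.degree < Fintype.card F := by
    refine (Polynomial.degree_sum_le _ _).trans_lt
      ((Finset.sup_lt_iff (WithBot.bot_lt_coe _)).2 fun K _ => ?_)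
    refine (Polynomial.degree_C_mul_X_pow_le _ _).trans_lt ?_
    rw [hF]
    exact_mod_cast binaryExponent_lt K
  have h0 : p = 0 := Polynomial.eq_zero_of_degree_lt_of_eval_finset_eq_zero univ
    (by simpa using hdeg) fun x _ => by simpa [hp, Polynomial.eval_finsetSum] using h x
  have h1 : p.coeff (binaryExponent K) = c K := by
    rw [hp, Polynomial.finsetSum_coeff]
    simp only [Polynomial.coeff_C_mul_X_pow]
    rw [sum_eq_single K]
    · simp
    · intro L _ hL
      rw [if_neg fun e => hL (binaryExponent_injective e.symm)]
    · simp
  rw [← h1, h0, Polynomial.coeff_zero]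

theorem pow_two_pow_val_add (hF : Fintype.card F = 2 ^ m) (x : F) (i t : ZMod m) :
    x ^ 2 ^ (i + t).val = (x ^ 2 ^ i.val) ^ 2 ^ t.val := by
  rw [ZMod.val_add, pow_two_pow_mod hF, pow_add, pow_mul]

/-- Since x^(2^m) = x, rotating the digits cyclically by t amounts to applying Frobenius t times. -/
theorem pow_binaryExponent_map_add (hF : Fintype.card F = 2 ^ m) (x : F) (I : Finset (ZMod m))
    (t : ZMod m) :
    x ^ binaryExponent (I.map (addRightEmbedding t)) = (x ^ binaryExponent I) ^ 2 ^ t.val := by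
  rw [← prod_pow_two_pow_val, prod_map, ← prod_pow_two_pow_val, ← prod_pow]
  exact prod_congr rfl fun i _ => pow_two_pow_val_add hF x i t

theorem algebraMap_absTrace [Algebra (ZMod 2) F] (hF : Fintype.card F = 2 ^ m) (y : F) :
    algebraMap (ZMod 2) F (absTrace y) = ∑ t : ZMod m, y ^ 2 ^ t.val := by
  rw [absTrace, FiniteField.algebraMap_trace_eq_sum_pow, finrank_eq_of_card hF, Nat.card_zmod]
  refine sum_bij' (fun i _ => (i : ZMod m)) (fun t _ => t.val) (fun _ _ => mem_univ _)
    (fun t _ => mem_range.2 (ZMod.val_lt t)) (fun i hi => ZMod.val_cast_of_lt (mem_range.1 hi))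
    (fun t _ => ZMod.natCast_zmod_val t) fun i hi => ?_
  rw [ZMod.val_cast_of_lt (mem_range.1 hi)]

theorem even_translates_of_linear_structure [Algebra (ZMod 2) F] (hF : Fintype.card F = 2 ^ m)
    (I : Finset (ZMod m))
    (h : ∀ x : F, absTrace ((x + 1) ^ binaryExponent I + x ^ binaryExponent I) = 1)
    (K : Finset (ZMod m)) (hK : K.Nonempty) (hKI : #K < #I) :
    Even #{t : ZMod m | ∀ k ∈ K, k - t ∈ I} := by
  have hchar := charTwo_of_algebra F
  have hsub : ∀ (K : Finset (ZMod m)) (t : ZMod m),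
      K ⊆ I.map (addRightEmbedding t) ↔ ∀ k ∈ K, k - t ∈ I := by
    intro K t
    refine forall₂_congr fun k _ => ?_
    simp only [mem_map, addRightEmbedding_apply]
    exact ⟨fun ⟨a, ha, hk⟩ => by rw [← hk, add_sub_cancel_right]; exact ha,
      fun hk => ⟨k - t, hk, sub_add_cancel k t⟩⟩
  -- These are the coefficients of tr((x+1)^d) + tr(x^d) − 1: the trace runs over the translates of
  -- I, and (x+1) to a translate expands over its subsets.
  set c : Finset (ZMod m) → F := fun K =>
    (#{t : ZMod m | K ⊆ I.map (addRightEmbedding t)} : F) +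
      #{t : ZMod m | K = I.map (addRightEmbedding t)} - if K = ∅ then 1 else 0 with hc
  have hzero : ∀ x : F, ∑ K, c K * x ^ binaryExponent K = 0 := by
    intro x
    have hx := congrArg (algebraMap (ZMod 2) F) (h x)
    rw [map_one, absTrace_add, map_add, algebraMap_absTrace hF, algebraMap_absTrace hF] at hx
    have e1 : ∀ t : ZMod m, ((x + 1) ^ binaryExponent I) ^ 2 ^ t.val =
        ∑ K, if K ⊆ I.map (addRightEmbedding t) then x ^ binaryExponent K else 0 := by
      intro t
      rw [← pow_binaryExponent_map_add hF, ← prod_pow_two_pow_val]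
      simp_rw [add_pow_char_pow, one_pow]
      rw [prod_add_one, ← sum_filter]
      refine sum_congr ?_ fun L _ => prod_pow_two_pow_val L x
      ext; simp
    have e2 : ∀ t : ZMod m, (x ^ binaryExponent I) ^ 2 ^ t.val =
        ∑ K, if K = I.map (addRightEmbedding t) then x ^ binaryExponent K else 0 := by
      intro t
      rw [← pow_binaryExponent_map_add hF]
      simp
    simp_rw [e1, e2] at hx
    rw [sum_comm, sum_comm (f := fun t K =>
      if K = I.map (addRightEmbedding t) then x ^ binaryExponent K else 0)] at hx
    have e3 : (1 : F) = ∑ K : Finset (ZMod m), (if K = ∅ then 1 else 0) * x ^ binaryExponent K := by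
      simp [binaryExponent]
    rw [e3, ← sub_eq_zero, ← sum_add_distrib, ← sum_sub_distrib] at hx
    rw [← hx]
    refine sum_congr rfl fun K _ => ?_
    rw [← sum_filter, ← sum_filter, sum_const, sum_const, nsmul_eq_mul, nsmul_eq_mul, hc]
    ring
  have hcK := coeff_eq_zero_of_sum_monomials_eq_zero hF c hzero K
  have hn : #{t : ZMod m | K = I.map (addRightEmbedding t)} = 0 := by
    rw [card_eq_zero, filter_eq_empty_iff]
    rintro t - rfl
    simp at hKI
  simp only [hc, hn, if_neg hK.ne_empty, Nat.cast_zero, add_zero, sub_zero] at hcK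
  simp only [hsub] at hcK
  rw [CharP.cast_eq_zero_iff F 2] at hcK
  exact even_iff_two_dvd.2 hcK

theorem exists_primitive_unit (F : Type*) [Field F] [Fintype F] :
    ∃ g : Fˣ, orderOf g = Fintype.card F - 1 := by
  obtain ⟨g, hg⟩ := IsCyclic.exists_ofOrder_eq_natCard (α := Fˣ)
  classical
  exact ⟨g, by rw [hg, Nat.card_eq_fintype_card, Fintype.card_units]⟩

/-- If I = I + t, then x^(2^t) and x have the same power, so injectivity makes the t-th Frobenius
power trivial. Testing on a generator of the unit group gives t = 0. -/
theorem card_self_translates_of_pow_injective (hF : Fintype.card F = 2 ^ m) (hm : 2 ≤ m)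
    (I : Finset (ZMod m)) (hinj : Function.Injective fun x : F => x ^ binaryExponent I) :
    #{t : ZMod m | ∀ k ∈ I, k - t ∈ I} = 1 := by
  rw [card_eq_one]
  refine ⟨0, eq_singleton_iff_unique_mem.2 ⟨by simp, fun t ht => ?_⟩⟩
  simp only [mem_filter, mem_univ, true_and] at ht
  have hI : I = I.map (addRightEmbedding t) := by
    refine eq_of_subset_of_card_le (fun k hk => mem_map.2 ⟨k - t, ht k hk, ?_⟩) (by simp)
    simp
  have hx : ∀ x : F, x ^ 2 ^ t.val = x := fun x => hinj (by
    simp only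
    conv_rhs => rw [hI, pow_binaryExponent_map_add hF]
    rw [← pow_mul, ← pow_mul, mul_comm])
  obtain ⟨g, hg⟩ := exists_primitive_unit F
  have h1 : g ^ 2 ^ t.val = g ^ 1 := by
    ext; simpa using hx g
  have h4 : 2 ^ m = 2 * 2 ^ (m - 1) := by rw [← pow_succ', Nat.sub_add_cancel (by omega)]
  have h5 : 2 ^ 1 ≤ 2 ^ (m - 1) := Nat.pow_le_pow_right two_pos (by omega)
  have h6 : 2 ^ t.val ≤ 2 ^ (m - 1) :=
    Nat.pow_le_pow_right two_pos (by have := ZMod.val_lt t; omega)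
  have h2 := pow_injOn_Iio_orderOf (x := g) (by rw [Set.mem_Iio, hg, hF]; omega)
    (by rw [Set.mem_Iio, hg, hF]; omega) h1
  rw [← ZMod.val_eq_zero]
  exact Nat.pow_right_injective le_rfl (h2.trans (pow_zero 2).symm)

theorem exists_ne_one_pow_two_pow_eq_self (hF : Fintype.card F = 2 ^ m) {k : ℕ}
    (hk : Nat.gcd k m ≠ 1) : ∃ a : F, a ≠ 0 ∧ a ≠ 1 ∧ a ^ 2 ^ k = a := by
  set g := Nat.gcd k m with hg
  have hm0 : m ≠ 0 := NeZero.ne m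
  have hg0 : 0 < g := Nat.gcd_pos_of_pos_right k (Nat.pos_of_ne_zero hm0)
  have hg2 : 2 ^ 2 ≤ 2 ^ g := Nat.pow_le_pow_right two_pos (by omega)
  obtain ⟨j, hj⟩ := Nat.gcd_dvd_right k m
  obtain ⟨s, hs⟩ : 2 ^ g - 1 ∣ 2 ^ m - 1 := by
    rw [hj, ← hg, pow_mul]
    simpa using Nat.sub_dvd_pow_sub_pow (2 ^ g) 1 j
  obtain ⟨u, hu⟩ := exists_primitive_unit F
  rw [hF] at hu
  have hm1 : 1 < 2 ^ m := Nat.one_lt_two_pow hm0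
  have hs0 : 0 < s := by
    rcases Nat.eq_zero_or_pos s with h | h
    · rw [h, mul_zero] at hs; omega
    · exact h
  -- With s = (2^m − 1)/(2^g − 1), this element generates the units of the subfield of order 2^g,
  -- where g ≥ 2.
  refine ⟨(u ^ s : Fˣ), Units.ne_zero _, fun h => ?_, ?_⟩
  · have h1 : u ^ s = 1 := Units.ext h
    have h2 := Nat.le_of_dvd hs0 (orderOf_dvd_of_pow_eq_one h1)
    rw [hu, hs] at h2
    nlinarith [show 3 ≤ 2 ^ g - 1 by omega]
  · have h1 : (u ^ s) ^ (2 ^ g - 1) = 1 := by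
      rw [← pow_mul, mul_comm, ← hs, ← hu, pow_orderOf_eq_one]
    have h2 : (u ^ s) ^ 2 ^ g = u ^ s := by
      conv_lhs => rw [← Nat.sub_add_cancel (Nat.one_le_two_pow (n := g)), pow_succ, h1, one_mul]
    have h3 : ∀ n, (u ^ s) ^ 2 ^ (g * n) = u ^ s := by
      intro n
      induction n with
      | zero => simp
      | succ n ih => rw [Nat.mul_succ, pow_add, pow_mul, ih, h2]
    obtain ⟨n, hn⟩ := Nat.gcd_dvd_left k m
    have := h3 n
    rw [hg, ← hn] at this
    exact congrArg Units.val this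

end BinaryExpansion

theorem pow_eq_pow_of_modEq_card_sub_one {F : Type*} [Field F] [Fintype F] {a b : ℕ} (ha : a ≠ 0)
    (hb : b ≠ 0) (h : a ≡ b [MOD Fintype.card F - 1]) (x : F) : x ^ a = x ^ b := by
  by_cases hx : x = 0
  · rw [hx, zero_pow ha, zero_pow hb]
  · exact pow_eq_pow_of_modEq h (FiniteField.pow_card_sub_one_eq_one x hx)

/-! ### Gold exponents -/

section Gold

variable {F : Type*} [Field F] [Algebra (ZMod 2) F] [Fintype F]

theorem traceSign_pow_two_pow (x : F) (n : ℕ) : traceSign (x ^ 2 ^ n) = traceSign x := by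
  rw [traceSign, absTrace_pow_two_pow]; rfl

/-- If `a` is fixed by the `k`-th Frobenius power, it is a linear structure of the trace of
`x ^ (2 ^ i * (2 ^ k + 1))`. -/
theorem traceSign_gold_derivative (i k : ℕ) {a : F} (ha : a ^ 2 ^ k = a) (x : F) :
    traceSign ((x + a) ^ (2 ^ i * (2 ^ k + 1)) + x ^ (2 ^ i * (2 ^ k + 1))) = traceSign a := by
  have := charTwo_of_algebra F
  rw [mul_comm, pow_mul, pow_mul, ← add_pow_char_pow, traceSign_pow_two_pow, pow_succ, pow_succ,
    add_pow_char_pow, ha]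
  have e : (x ^ 2 ^ k + a) * (x + a) + x ^ 2 ^ k * x =
      x ^ 2 ^ k * a + x * a + a * a := by
    linear_combination CharTwo.add_self_eq_zero (x ^ 2 ^ k * x)
  -- The two mixed terms are Frobenius conjugates, so their traces cancel and only tr(a²) = tr a
  -- remains.
  have h1 : x ^ 2 ^ k * a = (x * a) ^ 2 ^ k := by rw [mul_pow, ha]
  rw [e, h1, traceSign_add, traceSign_add, traceSign_pow_two_pow, traceSign_mul_self, one_mul,
    ← sq, traceSign_sq]

theorem linear_structure_of_isGoldExponentUpToConj {m d : ℕ} (hm : Odd m)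
    (hF : Fintype.card F = 2 ^ m) (hd : d ≠ 0) (h : IsGoldExponentUpToConj m d) (x : F) :
    traceSign ((x + 1) ^ d + x ^ d) = -1 := by
  obtain ⟨e, i, ⟨k, -, rfl⟩, he⟩ := h
  have : NeZero m := ⟨by rintro rfl; exact absurd hm (by decide)⟩
  rw [← hF] at he
  have h0 : 2 ^ i * (2 ^ k + 1) ≠ 0 := by positivity
  rw [pow_eq_pow_of_modEq_card_sub_one hd h0 he, pow_eq_pow_of_modEq_card_sub_one hd h0 he,
    traceSign_gold_derivative i k (one_pow _), traceSign_one (by rwa [finrank_eq_of_card hF])]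

/-- A maximum nonlinear power function whose trace has Walsh support `{γ | tr γ = 1}` has a Gold
exponent. -/
theorem exists_mod_eq_gold_of_walsh_sq {m d : ℕ} (hm : 2 ≤ m) (hF : Fintype.card F = 2 ^ m)
    (hd : d ≠ 0) (hinj : Function.Injective fun x : F => x ^ d)
    (h : ∀ γ : F, walsh (fun x : F => x ^ d) 1 γ ^ 2 = Fintype.card F * (1 - traceSign γ)) :
    ∃ i k : ℕ, Nat.gcd k m = 1 ∧ d % (2 ^ m - 1) = 2 ^ i * (2 ^ k + 1) := by
  classical
  have : NeZero m := ⟨by omega⟩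
  have hchar := charTwo_of_algebra F
  have h4 : 2 ^ 2 ≤ 2 ^ m := Nat.pow_le_pow_right two_pos hm
  obtain ⟨c, hc0, hc1⟩ : ∃ c : F, c ≠ 0 ∧ c ≠ 1 := by
    obtain ⟨c, -, hc⟩ := exists_mem_notMem_of_card_lt_card (s := ({0, 1} : Finset F)) (t := univ)
      (card_le_two.trans_lt (by rw [Finset.card_univ, hF]; omega))
    exact ⟨c, by simpa using hc⟩
  set r := d % (2 ^ m - 1) with hr
  have hmod : d ≡ r [MOD Fintype.card F - 1] := by rw [hF]; exact (Nat.mod_modEq _ _).symm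
  have hr0 : r ≠ 0 := by
    intro h0
    rw [h0] at hmod
    refine hc1 (hinj ?_)
    simp only
    rw [pow_eq_pow_of_modEq hmod (FiniteField.pow_card_sub_one_eq_one c hc0), pow_zero, one_pow]
  have hpow : ∀ x : F, x ^ d = x ^ r := pow_eq_pow_of_modEq_card_sub_one hd hr0 hmod
  obtain ⟨I, hI⟩ := exists_binaryExponent_eq (m := m) (d := r)
    ((Nat.mod_lt _ (by omega)).trans (by omega))
  have hnc : ∀ a : F, a ≠ 0 → a ≠ 1 → ∀ b : F,
      ¬ ∀ x : F, traceSign ((x + a) ^ r + x ^ r) = traceSign b := by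
    intro a h0 h1 b hall
    obtain ⟨x, hx⟩ := not_const_autocorrelation h h0 h1 b
    rw [hpow, hpow] at hx
    exact hx (hall x)
  have hlin : ∀ x : F, absTrace ((x + 1) ^ binaryExponent I + x ^ binaryExponent I) = 1 := by
    intro x
    rw [← traceSign_eq_neg_one_iff, hI, ← hpow, ← hpow]
    exact linear_structure_of_walsh_sq h x
  have hcard := card_le_two_of_even_translates I
    (fun K hK hKn hKne => even_translates_of_linear_structure hF I hlin K hKn
      (card_lt_card (hK.ssubset_of_ne hKne)))
    (card_self_translates_of_pow_injective hF hm I (by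
      rw [hI]; simpa only [hpow] using hinj))
  have hgold : ∀ a b : ZMod m, a.val < b.val → I = {a, b} →
      ∃ i k : ℕ, Nat.gcd k m = 1 ∧ r = 2 ^ i * (2 ^ k + 1) := by
    intro a b hab hIab
    -- Taking the smaller digit as i makes this an equality of integers, not just a congruence; part
    -- (b) relies on that.
    have hre : r = 2 ^ a.val * (2 ^ (b.val - a.val) + 1) := by
      rw [← hI, hIab, binaryExponent, sum_pair (by rintro rfl; exact lt_irrefl _ hab), mul_add,
        ← pow_add, Nat.add_sub_cancel' hab.le, mul_one, add_comm]
    refine ⟨a.val, b.val - a.val, ?_, hre⟩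
    by_contra hg
    obtain ⟨s, hs0, hs1, hs⟩ := exists_ne_one_pow_two_pow_eq_self hF hg
    refine hnc s hs0 hs1 s fun x => ?_
    rw [hre]
    exact traceSign_gold_derivative _ _ hs x
  interval_cases hn : #I
  · rw [card_eq_zero.1 hn] at hI
    exact absurd hI.symm hr0
  · obtain ⟨a, rfl⟩ := card_eq_one.1 hn
    rw [binaryExponent, sum_singleton] at hI
    -- With a single digit x^r is additive, so the derivative in direction c is the constant c^r.
    refine absurd (fun x => ?_) (hnc c hc0 hc1 (c ^ r))
    rw [← hI, add_pow_char_pow, add_right_comm, CharTwo.add_self_eq_zero, zero_add]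
  · obtain ⟨a, b, hab, hIab⟩ := card_eq_two.1 hn
    rcases lt_trichotomy a.val b.val with hlt | heq | hlt
    · exact hgold a b hlt hIab
    · exact absurd (ZMod.val_injective m heq) hab
    · exact hgold b a hlt (by rw [hIab, pair_comm])

end Gold

/-! ### Conclusion -/

theorem isGoldExponent_of_odd {m i k d : ℕ} (hk : Nat.gcd k m = 1) (hd : Odd d)
    (h : d = 2 ^ i * (2 ^ k + 1)) : IsGoldExponent m d := by
  rcases Nat.eq_zero_or_pos i with rfl | hi
  · exact ⟨k, hk, by rw [h, pow_zero, one_mul]⟩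
  · rw [h, Nat.odd_mul] at hd
    exact absurd hd.1 (Nat.not_odd_iff_even.2 (even_two.pow_of_ne_zero hi.ne'))

theorem theorem1 {F : Type*} [Field F] [Fintype F] [Algebra (ZMod 2) F] (m d : ℕ)
    (hm : Odd m) (hF : Fintype.card F = 2 ^ m)
    (hd : IsMaximumNonlinear fun x : F => x ^ d) :
    (IsGoldExponentUpToConj m d ↔ HasQuadricIntersections F m d) ∧
      (Odd d → d < 2 ^ m - 1 → (IsGoldExponent m d ↔ HasQuadricIntersections F m d)) := by
  by_cases hm1 : m = 1
  · subst hm1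
    -- For m = 1 there are no two distinct nonzero elements, all exponents agree modulo 2^1 − 1 = 1,
    -- and no odd d lies below 1.
    refine ⟨⟨fun _ α β hα hβ hαβ => ?_, fun _ => ⟨2 ^ 1 + 1, 0, ⟨1, rfl, rfl⟩, ?_⟩⟩,
      fun _ h => ?_⟩
    · classical
      have h3 : #({0, α, β} : Finset F) ≤ 2 := by
        rw [← pow_one 2, ← hF]; exact card_le_univ _
      rw [card_eq_three.2 ⟨0, α, β, hα.symm, hβ.symm, hαβ, rfl⟩] at h3
      omega
    · exact Nat.modEq_one
    · have hd0 : d = 0 := by omega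
      subst hd0
      exact absurd ‹Odd 0› (by decide)
  obtain ⟨n, rfl⟩ : ∃ n, m = 2 * n + 3 := by
    obtain ⟨k, hk⟩ := hm
    exact ⟨k - 1, by omega⟩
  have h2 : 2 < Fintype.card F := by
    have : 2 ^ 2 ≤ 2 ^ (2 * n + 3) := Nat.pow_le_pow_right two_pos (by omega)
    omega
  have hd0 := hd.exponent_ne_zero h2
  have hforward : IsGoldExponentUpToConj (2 * n + 3) d →
      HasQuadricIntersections F (2 * n + 3) d := fun h =>
    (hasQuadricIntersections_iff_walsh_sq hF hd).2 (walsh_sq_of_linear_structure hd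
      (linear_structure_of_isGoldExponentUpToConj hm hF hd0 h))
  have hbackward : HasQuadricIntersections F (2 * n + 3) d →
      ∃ i k : ℕ, Nat.gcd k (2 * n + 3) = 1 ∧ d % (2 ^ (2 * n + 3) - 1) = 2 ^ i * (2 ^ k + 1) :=
    fun h => exists_mod_eq_gold_of_walsh_sq (by omega) hF hd0 (hd.pow_injective h2)
      ((hasQuadricIntersections_iff_walsh_sq hF hd).1 h)
  refine ⟨⟨hforward, fun h => ?_⟩, fun hodd hlt => ⟨fun h => ?_, fun h => ?_⟩⟩
  · obtain ⟨i, k, hk, hdk⟩ := hbackward h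
    exact ⟨2 ^ k + 1, i, ⟨k, hk, rfl⟩, by rw [← hdk]; exact (Nat.mod_modEq _ _).symm⟩
  · exact hforward ⟨d, 0, h, by rw [pow_zero, one_mul]⟩
  · obtain ⟨i, k, hk, hdk⟩ := hbackward h
    rw [Nat.mod_eq_of_lt hlt] at hdk
    exact isGoldExponent_of_odd hk hodd hdk
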